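/- Let $\mathbb F$ be a field of characteristic $0$, let $n\ge 1$, and let $B$ be a nilpotent $n\times n$ matrix over $\mathbb F$ whose Jordan blocks have orders $\mu_1\ge\mu_2\ge\dots\ge\mu_t>0$. Let $\mathcal N_B$ be the set of all nilpotent $n\times n$ matrices $A$ over $\mathbb F$ with $AB=BA$, and for a nilpotent matrix $A$ let $\operatorname{nil}(A)=\min\{k\ge 0 : A^k=0\}$ be its index of nilpotency. Put $\mu_0=\mu_1+1$. Then $$\max_{A\in\mathcal N_B}\operatorname{nil}(A)=\max\bigl\{\,2i+\mu_{i+1}+\mu_{i+2}+\dots+\mu_{i+r}\;:\;0\le i<t,\ 1\le r\le t-i,\ \mu_{i+1}-\mu_{i+r}\le 1,\ \mu_i\ne\mu_{i+1}\,\bigr\}.$$ In particular both maxima are attained. -/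

import Mathlib

/-- The nilpotent matrix in (upper triangular) Jordan canonical form with Jordan blocks of orders
`μ 0, μ 1, …, μ (t - 1)`, with eigenvalue `0`. The basis vectors are indexed by the pairs `⟨i, a⟩`,
`i` the number of the block and `a` the position inside it. -/
def nilpotentJordanForm (F : Type*) [Field F] {t : ℕ} (μ : Fin t → ℕ) :
    Matrix (Σ i : Fin t, Fin (μ i)) (Σ i : Fin t, Fin (μ i)) F :=
  Matrix.blockDiagonal' fun i : Fin t =>
    (Matrix.of fun a b : Fin (μ i) => if (a : ℕ) + 1 = (b : ℕ) then (1 : F) else 0)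

/-- `HasShape B μ`: the partition `μ = (μ 0 ≥ μ 1 ≥ … ≥ μ (t - 1) > 0)` is the shape of the
matrix `B`, that is, `B` is similar to the nilpotent Jordan matrix whose blocks have the orders
`μ i`. (The bijection `e` only numbers the basis vectors of the Jordan form by `Fin n`.) -/
structure HasShape {F : Type*} [Field F] {n t : ℕ}
    (B : Matrix (Fin n) (Fin n) F) (μ : Fin t → ℕ) : Prop where
  antitone : Antitone μ
  pos : ∀ i, 0 < μ i
  similar : ∃ (e : (Σ i : Fin t, Fin (μ i)) ≃ Fin n) (P : GL (Fin n) F),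
    B = (P : Matrix (Fin n) (Fin n) F) * Matrix.reindex e e (nilpotentJordanForm F μ) *
      ((P⁻¹ : GL (Fin n) F) : Matrix (Fin n) (Fin n) F)

/-- `𝒩_B`: the set of all nilpotent matrices that commute with `B`. -/
def nilpotentCommutant {F : Type*} [Field F] {n : ℕ} (B : Matrix (Fin n) (Fin n) F) :
    Set (Matrix (Fin n) (Fin n) F) :=
  {A | IsNilpotent A ∧ A * B = B * A}

/-- The set of the numbers `2i + μ_{i+1} + ⋯ + μ_{i+r}`, `0 ≤ i < t`, `1 ≤ r ≤ t - i`, such that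
`μ_{i+1} - μ_{i+r} ≤ 1` and `μ_i ≠ μ_{i+1}` (no condition if `i = 0`). The parts are numbered
from `0` here: `p` is the part `μ_{i+1}`, so that `i` parts precede it and `i = (p : ℕ)`,
`q` is the part `μ_{i+r}`, and `j` is the part `μ_i`. -/
def chainLengths {t : ℕ} (μ : Fin t → ℕ) : Set ℕ :=
  {v | ∃ p q : Fin t, p ≤ q ∧ μ p ≤ μ q + 1 ∧ (∀ j : Fin t, (j : ℕ) + 1 = (p : ℕ) → μ j ≠ μ p) ∧
    v = 2 * (p : ℕ) + ∑ k ∈ Finset.Icc p q, μ k}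

/-! Let `J` be the Jordan form and `A` nilpotent with `A J = J A`. Upper bound: `A` preserves the
corners `ker J ^ d ∩ im J ^ u`. Modulo the sum of the corners at `(u + 1, d + 1)` and `(u, d)`, the
corner at `(u, d + 1)` is spanned by one basis vector per block of order `u + d + 1`, so that many
applications of `A` push it into the sum. Hence the index of `A` is bounded by the weight of a
lattice path in which each visit to a level `u + d` costs the multiplicity of that part
(`pow_mulVec_eq_zero`). `pathBound` controls these weights, and an averaging argument bounds it by
one of the numbers in `chainLengths` (`pathBound_zero_le`, `chainWeight_le`,
`chainWeight_mem_chainLengths`). Lower bound: the 0/1 matrix of a strict relation on the basis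
commutes with `J` and is nilpotent. Its powers count walks, so in characteristic `0` a chain of `k +
1` basis vectors makes the `k`-th power nonzero; `exists_chain` supplies chains of the required
lengths. -/

/-! ### Weights of lattice paths -/

theorem add_sum_Ioc_succ (c : ℕ → ℕ) (M p : ℕ) (hc : ∀ q, M < q → c q = 0) :
    c (p + 1) + ∑ q ∈ Finset.Ioc (p + 1) M, c q = ∑ q ∈ Finset.Ioc p M, c q := by
  by_cases hM : p + 1 ≤ M
  · rw [← Finset.Icc_add_one_left_eq_Ioc p, Finset.add_sum_Ioc_eq_sum_Icc hM]
  · rw [hc _ (by omega), Finset.Ioc_eq_empty (by omega), Finset.Ioc_eq_empty (by omega)]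
    simp

/-- The bound for the weight of a monotone lattice path that starts at the point `(u, d)`. -/
def pathBound (c : ℕ → ℕ) (M u d : ℕ) : ℕ :=
  -- The path descends from level `u + d` to its lowest level `s` and climbs to `M`; its other `s -
  -- 1 - u` steps lowering `d` are paired with steps raising `u`, each pair visiting adjacent levels
  -- `q`, `q - 1`. For `d = 0` the supremum is empty, hence `0`.
  (Finset.Icc (u + 1) (u + d)).sup fun s =>
    ∑ q ∈ Finset.Icc s (u + d), c q + ∑ q ∈ Finset.Ioc s M, c q +
      (s - 1 - u) * (Finset.Ioc s (M + 1)).sup fun q => c q + c (q - 1)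

theorem pathBound_right (c : ℕ → ℕ) (M u d : ℕ) :
    c (u + (d + 1)) + pathBound c M u d ≤ pathBound c M u (d + 1) := by
  rcases Nat.eq_zero_or_pos d with rfl | hd
  · refine le_trans ?_ (Finset.le_sup (b := u + 1) (by simp))
    simp [pathBound]
  · have hne : (Finset.Icc (u + 1) (u + d)).Nonempty := ⟨u + 1, by simp; omega⟩
    obtain ⟨s, hs, h⟩ := Finset.exists_mem_eq_sup _ hne fun s =>
      ∑ q ∈ Finset.Icc s (u + d), c q + ∑ q ∈ Finset.Ioc s M, c q +
        (s - 1 - u) * (Finset.Ioc s (M + 1)).sup fun q => c q + c (q - 1)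
    rw [pathBound, h]
    rw [Finset.mem_Icc] at hs
    refine le_trans ?_ (Finset.le_sup (b := s) (by simp; omega))
    rw [← add_assoc u d 1, Finset.sum_Icc_succ_top (by omega)]
    omega

/-- If the optimal `s` lies below the level of `(u + 1, d + 1)`, keep it: that level and the new one
form one more oscillating pair. Otherwise the new starting level becomes the lowest one. -/
theorem pathBound_up (c : ℕ → ℕ) (M u d : ℕ) (hc : ∀ q, M < q → c q = 0) :
    c (u + (d + 1)) + pathBound c M (u + 1) (d + 1) ≤ pathBound c M u (d + 1) := by
  have hne : (Finset.Icc (u + 1 + 1) (u + 1 + (d + 1))).Nonempty := ⟨u + 2, by simp; omega⟩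
  obtain ⟨s, hs, h⟩ := Finset.exists_mem_eq_sup _ hne fun s =>
      ∑ q ∈ Finset.Icc s (u + 1 + (d + 1)), c q + ∑ q ∈ Finset.Ioc s M, c q +
        (s - 1 - (u + 1)) * (Finset.Ioc s (M + 1)).sup fun q => c q + c (q - 1)
  rw [pathBound, h]
  rw [Finset.mem_Icc] at hs
  have hl : u + 1 + (d + 1) = u + (d + 1) + 1 := by ring
  rcases Nat.lt_or_ge s (u + (d + 1) + 1) with hlt | hge
  · refine le_trans ?_ (Finset.le_sup (b := s) (by simp; omega))
    have hg : c (u + (d + 1) + 1) + c (u + (d + 1)) ≤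
        (Finset.Ioc s (M + 1)).sup fun q => c q + c (q - 1) := by
      by_cases hM : u + (d + 1) ≤ M
      · exact Finset.le_sup (f := fun q => c q + c (q - 1)) (b := u + (d + 1) + 1)
          (by simp; omega)
      · rw [hc _ (by omega), hc (u + (d + 1)) (by omega)]
        simp
    obtain ⟨k, hk⟩ : ∃ k, s = u + 2 + k := ⟨s - (u + 2), by omega⟩
    rw [hl, Finset.sum_Icc_succ_top (by omega), show s - 1 - u = (s - 1 - (u + 1)) + 1 by omega,
      add_mul, one_mul]
    omega
  · have hs' : s = u + (d + 1) + 1 := by omega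
    subst hs'
    refine le_trans ?_ (Finset.le_sup (b := u + (d + 1)) (by simp))
    have hsum := add_sum_Ioc_succ c M (u + (d + 1)) hc
    have hmono : ((Finset.Ioc (u + (d + 1) + 1) (M + 1)).sup fun q => c q + c (q - 1)) ≤
        (Finset.Ioc (u + (d + 1)) (M + 1)).sup fun q => c q + c (q - 1) :=
      Finset.sup_mono (Finset.Ioc_subset_Ioc_left (by omega))
    have := Nat.mul_le_mul_left (u + (d + 1) + 1 - 1 - (u + 1)) hmono
    rw [hl, Finset.Icc_self, Finset.Icc_self, Finset.sum_singleton, Finset.sum_singleton]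
    have he : u + (d + 1) - 1 - u = u + (d + 1) + 1 - 1 - (u + 1) := by omega
    rw [he]
    omega

/-- The sum of the parts equal to `p` or `p - 1` and of `2` for each part above `p`, if `c q` is
the multiplicity of the part `q`. -/
def chainWeight (c : ℕ → ℕ) (M p : ℕ) : ℕ :=
  2 * ∑ q ∈ Finset.Ioc p M, c q + p * c p + (p - 1) * c (p - 1)

/-- Let `p` maximise `c q + c (q - 1)` above `s`. Descent and climb between `s` and `p` consist of
`p - s` adjacent pairs and one extra `c p`; with the `s - 1` oscillations this is at most `p - 1`
maximal pairs plus `c p`. -/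
theorem pathBound_zero_le (c : ℕ → ℕ) (M m : ℕ) (hc : ∀ q, M < q → c q = 0)
    (hm : ∀ p, 1 ≤ p → chainWeight c M p ≤ m) : pathBound c M 0 M ≤ m := by
  refine Finset.sup_le fun s hs => ?_
  rw [Finset.mem_Icc] at hs
  have hne : (Finset.Ioc s (M + 1)).Nonempty := ⟨M + 1, by simp; omega⟩
  obtain ⟨p, hp, h⟩ := Finset.exists_mem_eq_sup _ hne fun q => c q + c (q - 1)
  have hle : ∀ q ∈ Finset.Ioc s (M + 1), c q + c (q - 1) ≤ c p + c (p - 1) := fun q hq => by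
    rw [← h]; exact Finset.le_sup (f := fun q => c q + c (q - 1)) hq
  rw [h]
  refine le_trans ?_ (hm p (by rw [Finset.mem_Ioc] at hp; omega))
  rw [Finset.mem_Ioc] at hp
  have key : ∀ k, s + k ≤ M + 1 → (∀ q, s < q → q ≤ s + k → c q + c (q - 1) ≤ c p + c (p - 1)) →
      c s + 2 * ∑ q ∈ Finset.Ioc s M, c q ≤
        k * (c p + c (p - 1)) + c (s + k) + 2 * ∑ q ∈ Finset.Ioc (s + k) M, c q := by
    intro k
    induction k with
    | zero => simp
    | succ k ih =>
      intro hk hq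
      have h1 := ih (by omega) fun q h1 h2 => hq q h1 (by omega)
      have h2 := hq (s + k + 1) (by omega) (by omega)
      have h3 := add_sum_Ioc_succ c M (s + k) hc
      rw [Nat.add_sub_cancel] at h2
      rw [add_mul, one_mul, ← add_assoc s k 1]
      omega
  obtain ⟨k, rfl⟩ : ∃ k, p = s + k := ⟨p - s, by omega⟩
  have h1 := key k hp.2 fun q h1 h2 => hle q (by rw [Finset.mem_Ioc]; omega)
  have h2 : ∑ q ∈ Finset.Icc s (0 + M), c q = c s + ∑ q ∈ Finset.Ioc s M, c q := by
    rw [zero_add, Finset.add_sum_Ioc_eq_sum_Icc (by omega)]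
  rw [h2, chainWeight]
  obtain ⟨r, rfl⟩ : ∃ r, s = r + 1 := ⟨s - 1, by omega⟩
  have h3 : r + 1 + k - 1 = r + k := by omega
  simp only [h3, Nat.add_sub_cancel, Nat.sub_zero] at h1 ⊢
  nlinarith

/-- If `c p = 0`, the weight does not drop on passing to `p - 1` when that is a positive part, and
otherwise on passing to `p + 1`, because `2 ≤ p + 1`. -/
theorem chainWeight_le (c : ℕ → ℕ) (M m : ℕ) (hc : ∀ q, M < q → c q = 0)
    (hm : ∀ p, 1 ≤ p → c p ≠ 0 → chainWeight c M p ≤ m) {p : ℕ} (hp : 1 ≤ p) :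
    chainWeight c M p ≤ m := by
  by_cases hM : M + 1 < p
  · simp [chainWeight, Finset.Ioc_eq_empty (show ¬ p < M by omega), hc p (by omega),
      hc (p - 1) (by omega)]
  push Not at hM
  induction hM using Nat.decreasingInduction with
  | self =>
    by_cases h0 : c M = 0
    · simp [chainWeight, hc (M + 1) (by omega), h0]
    · rcases Nat.eq_zero_or_pos M with rfl | hM
      · simp [chainWeight, hc 1 (by omega)]
      · refine le_trans ?_ (hm M hM h0)
        simp [chainWeight, hc (M + 1) (by omega)]
  | of_succ p hpM ih =>
    by_cases h0 : c p = 0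
    · by_cases h1 : (p - 1) * c (p - 1) = 0
      · refine le_trans ?_ (ih (by omega))
        have h3 := add_sum_Ioc_succ c M p hc
        have h4 : 2 * c (p + 1) ≤ (p + 1) * c (p + 1) := Nat.mul_le_mul_right _ (by omega)
        simp only [chainWeight, h0, h1]
        omega
      · obtain ⟨h2, h1⟩ := mul_ne_zero_iff.1 h1
        refine le_trans ?_ (hm (p - 1) (by omega) h1)
        have : ∑ q ∈ Finset.Ioc p M, c q ≤ ∑ q ∈ Finset.Ioc (p - 1) M, c q :=
          Finset.sum_le_sum_of_subset (Finset.Ioc_subset_Ioc_left (by omega))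
        simp only [chainWeight, h0]
        omega
    · exact hm p hp h0

/-! ### Nilpotent action on invariant quotients -/

theorem pow_finrank_eq_zero_of_isNilpotent {K V : Type*} [Field K] [AddCommGroup V] [Module K V]
    [FiniteDimensional K V] {f : Module.End K V} (hf : IsNilpotent f) {k : ℕ}
    (hk : Module.finrank K V ≤ k) : f ^ k = 0 := by
  have h := f.aeval_self_charpoly
  rw [IsNilpotent.charpoly_eq_X_pow_finrank hf, map_pow, Polynomial.aeval_X] at h
  exact pow_eq_zero_of_le hk h

/-- A nilpotent endomorphism acts nilpotently on the quotient of the invariant subspaces `Y ≤ X`,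
and so its `k`-th power is zero there if the quotient is spanned by `k` vectors `w i`. -/
theorem pow_mem_of_le_sup_span {K V : Type*} [Field K] [AddCommGroup V] [Module K V]
    [FiniteDimensional K V] {f : Module.End K V} (hf : IsNilpotent f) {X Y : Submodule K V}
    (hX : ∀ v ∈ X, f v ∈ X) (hY : ∀ v ∈ Y, f v ∈ Y) {ι : Type*}
    [Fintype ι] (w : ι → V) (hw : X ≤ Y ⊔ Submodule.span K (Set.range w)) {v : V} (hv : v ∈ X) :
    (f ^ Fintype.card ι) v ∈ Y := by
  have hpow : ∀ k v, ((Y.mapQ Y f hY) ^ k) (Y.mkQ v) = Y.mkQ ((f ^ k) v) := by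
    intro k
    induction k with
    | zero => simp
    | succ k ih =>
      intro v
      rw [pow_succ, pow_succ, Module.End.mul_apply, Module.End.mul_apply, ← ih]
      simp
  set Q := X.map Y.mkQ
  have hQ : ∀ q ∈ Q, (Y.mapQ Y f hY) q ∈ Q := by
    rintro _ ⟨x, hx, rfl⟩
    exact ⟨f x, hX x hx, by simp⟩
  have hnil : IsNilpotent ((Y.mapQ Y f hY).restrict hQ) := by
    obtain ⟨k, hk⟩ := hf
    refine ⟨k, ?_⟩
    ext ⟨_, x, hx, rfl⟩
    rw [Module.End.pow_restrict, LinearMap.restrict_apply]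
    simp only [hpow, hk]
    simp
  have hfin : Module.finrank K Q ≤ Fintype.card ι := by
    have hle : Q ≤ Submodule.span K (Set.range (Y.mkQ ∘ w)) := by
      refine (Submodule.map_mono hw).trans ?_
      rw [Submodule.map_sup, Submodule.map_span, ← Set.range_comp]
      simp
    exact (Submodule.finrank_mono hle).trans (finrank_range_le_card _)
  have h := LinearMap.congr_fun (pow_finrank_eq_zero_of_isNilpotent hnil hfin) ⟨Y.mkQ v, v, hv, rfl⟩
  rw [Module.End.pow_restrict] at h
  have h2 := congrArg Subtype.val h
  rw [LinearMap.coe_restrict_apply] at h2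
  simp only [hpow] at h2
  simpa using h2

/-! ### Filtration of the Jordan module by kernels and images -/

section JordanForm

variable {F : Type*} [Field F] {t : ℕ} {μ : Fin t → ℕ}

theorem nilpotentJordanForm_apply (x y : Σ i : Fin t, Fin (μ i)) :
    nilpotentJordanForm F μ x y = if x.1 = y.1 ∧ (x.2 : ℕ) + 1 = y.2 then 1 else 0 := by
  obtain ⟨i, a⟩ := x
  obtain ⟨j, b⟩ := y
  by_cases h : i = j
  · subst h
    simp [nilpotentJordanForm]
  · simp [nilpotentJordanForm, Matrix.blockDiagonal'_apply_ne _ _ _ h, h]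

theorem nilpotentJordanForm_mulVec (v : (Σ i : Fin t, Fin (μ i)) → F) (i : Fin t) (a : Fin (μ i)) :
    (nilpotentJordanForm F μ).mulVec v ⟨i, a⟩ =
      if h : (a : ℕ) + 1 < μ i then v ⟨i, a + 1, h⟩ else 0 := by
  simp only [Matrix.mulVec, dotProduct, nilpotentJordanForm_apply, ite_mul, one_mul, zero_mul]
  split_ifs with h
  · rw [Finset.sum_eq_single ⟨i, a + 1, h⟩] <;> simp
    rintro ⟨j, b⟩ hne rfl hab
    exact absurd (by congr 1; ext; exact hab.symm) hne
  · refine Finset.sum_eq_zero fun y _ => if_neg ?_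
    rintro ⟨rfl, hy⟩
    exact h (hy ▸ y.2.2)

theorem nilpotentJordanForm_pow_mulVec (k : ℕ) (v : (Σ i : Fin t, Fin (μ i)) → F) (i : Fin t)
    (a : Fin (μ i)) : ((nilpotentJordanForm F μ) ^ k).mulVec v ⟨i, a⟩ =
      if h : (a : ℕ) + k < μ i then v ⟨i, a + k, h⟩ else 0 := by
  induction k generalizing a with
  | zero => simp
  | succ k ih =>
    rw [pow_succ', ← Matrix.mulVec_mulVec, nilpotentJordanForm_mulVec]
    split_ifs with h1 h2 h2
    · rw [ih, dif_pos (by simp; omega)]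
      congr 2; ext; simp; omega
    · rw [ih, dif_neg (by simp; omega)]
    · omega
    · rfl

variable (F μ) in
/-- The span of the basis vectors in `ker J ^ d ∩ im J ^ u`, where `J` is the Jordan form. -/
def jordanCorner (u d : ℕ) : Submodule F ((Σ i : Fin t, Fin (μ i)) → F) where
  carrier := {v | ∀ x, v x ≠ 0 → (x.2 : ℕ) < d ∧ x.2 + u < μ x.1}
  zero_mem' := by simp
  add_mem' {v w} hv hw x hx := by
    by_cases h : v x = 0
    · exact hw x fun h' => hx (by simp [h, h'])
    · exact hv x h
  smul_mem' r v hv x hx := hv x fun h => hx (by simp [h])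

/-- Kernel and image of powers of `J` make the corner invariant under every matrix commuting with
`J`. -/
theorem mem_jordanCorner_iff {u d : ℕ} {v : (Σ i : Fin t, Fin (μ i)) → F} :
    v ∈ jordanCorner F μ u d ↔ ((nilpotentJordanForm F μ) ^ d).mulVec v = 0 ∧
      ∃ w, ((nilpotentJordanForm F μ) ^ u).mulVec w = v := by
  refine ⟨fun hv => ⟨?_, fun x => if h : u ≤ (x.2 : ℕ) then v ⟨x.1, x.2 - u, by omega⟩ else 0,
    ?_⟩, ?_⟩
  · ext ⟨i, a⟩
    rw [nilpotentJordanForm_pow_mulVec]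
    split_ifs with h
    · by_contra hne
      have := (hv _ hne).1
      simp at this
    · rfl
  · ext ⟨i, a⟩
    rw [nilpotentJordanForm_pow_mulVec]
    by_cases h : (a : ℕ) + u < μ i
    · simp [h]
    · rw [dif_neg h]
      by_contra hne
      exact h (hv ⟨i, a⟩ (Ne.symm hne)).2
  · rintro ⟨h, w, rfl⟩ ⟨i, a⟩ hx
    constructor
    · by_contra hd
      have := congrFun h ⟨i, a - d, by omega⟩
      rw [nilpotentJordanForm_pow_mulVec, dif_pos (by simp at hd ⊢; omega)] at this
      refine hx ?_
      rw [Pi.zero_apply] at this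
      rw [← this]
      congr 2; ext; simp at hd ⊢; omega
    · by_contra hu
      rw [nilpotentJordanForm_pow_mulVec, dif_neg hu] at hx
      exact hx rfl

theorem mulVec_mem_jordanCorner {A : Matrix (Σ i : Fin t, Fin (μ i)) (Σ i : Fin t, Fin (μ i)) F}
    (hA : Commute A (nilpotentJordanForm F μ)) {u d : ℕ} {v : (Σ i : Fin t, Fin (μ i)) → F}
    (hv : v ∈ jordanCorner F μ u d) : A.mulVec v ∈ jordanCorner F μ u d := by
  rw [mem_jordanCorner_iff] at hv ⊢
  obtain ⟨h, w, rfl⟩ := hv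
  refine ⟨?_, A.mulVec w, ?_⟩
  · rw [Matrix.mulVec_mulVec _ _ A, ← (hA.pow_right d).eq, ← Matrix.mulVec_mulVec, h,
      Matrix.mulVec_zero]
  · rw [Matrix.mulVec_mulVec, ← (hA.pow_right u).eq, ← Matrix.mulVec_mulVec]

/-- A basis vector of the left corner missed by both smaller corners has position exactly `d`, in a
block of order exactly `u + d + 1`. -/
theorem jordanCorner_le (u d : ℕ) :
    jordanCorner F μ u (d + 1) ≤ (jordanCorner F μ (u + 1) (d + 1) ⊔ jordanCorner F μ u d) ⊔
      Submodule.span F (Set.range fun i : {i // μ i = u + (d + 1)} =>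
        (Pi.single ⟨i.1, d, by rw [i.2]; omega⟩ 1 : (Σ i : Fin t, Fin (μ i)) → F)) := by
  intro v hv
  rw [← Finset.univ_sum_single v]
  refine Submodule.sum_mem _ fun x _ => ?_
  by_cases h0 : v x = 0
  · simp [h0]
  have hx := hv x h0
  by_cases h1 : x.2 + (u + 1) < μ x.1
  · refine Submodule.mem_sup_left (Submodule.mem_sup_left fun y hy => ?_)
    obtain rfl : y = x := by by_contra h; simp [h] at hy
    exact ⟨hx.1, h1⟩
  by_cases h2 : (x.2 : ℕ) < d
  · refine Submodule.mem_sup_left (Submodule.mem_sup_right fun y hy => ?_)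
    obtain rfl : y = x := by by_contra h; simp [h] at hy
    exact ⟨h2, hx.2⟩
  refine Submodule.mem_sup_right ?_
  rw [show Pi.single x (v x) = v x • Pi.single x (1 : F) by rw [← Pi.single_smul]; simp]
  refine Submodule.smul_mem _ _ (Submodule.subset_span ?_)
  refine ⟨⟨x.1, by omega⟩, ?_⟩
  have : (⟨x.1, d, by omega⟩ : Σ i : Fin t, Fin (μ i)) = x := by
    obtain ⟨i, a⟩ := x
    congr 1
    ext
    simp at hx h2 ⊢
    omega
  simp only [this]

/-- If `b` bounds the weights of the monotone lattice paths, then `A ^ b u d` vanishes on the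
subspace `jordanCorner F μ u d`. -/
theorem pow_mulVec_eq_zero {A : Matrix (Σ i : Fin t, Fin (μ i)) (Σ i : Fin t, Fin (μ i)) F}
    (hA : IsNilpotent A) (hAJ : Commute A (nilpotentJordanForm F μ)) {b : ℕ → ℕ → ℕ}
    (hb : ∀ u d, (Finset.univ.filter fun i => μ i = u + (d + 1)).card + b (u + 1) (d + 1) ≤
      b u (d + 1))
    (hb' : ∀ u d, (Finset.univ.filter fun i => μ i = u + (d + 1)).card + b u d ≤ b u (d + 1))
    {M : ℕ} (hM : ∀ i, μ i ≤ M) (k d : ℕ) : ∀ u, M ≤ u + k →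
      ∀ v ∈ jordanCorner F μ u d, (A ^ b u d).mulVec v = 0 := by
  have hzero : ∀ u d, M ≤ u ∨ d = 0 → ∀ v ∈ jordanCorner F μ u d, (A ^ b u d).mulVec v = 0 := by
    intro u d h v hv
    have : v = 0 := by
      ext x
      by_contra hx
      have h1 := hv x hx
      have h2 := hM x.1
      omega
    rw [this, Matrix.mulVec_zero]
  have hkill : ∀ {p q : ℕ} {v : (Σ i : Fin t, Fin (μ i)) → F}, (A ^ p).mulVec v = 0 → p ≤ q →
      (A ^ q).mulVec v = 0 := by
    intro p q v h hpq
    obtain ⟨r, rfl⟩ := Nat.exists_eq_add_of_le' hpq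
    rw [pow_add, ← Matrix.mulVec_mulVec, h, Matrix.mulVec_zero]
  -- Passing to `(u + 1, d + 1)` lowers `k`; passing to `(u, d)` lowers `d`.
  induction k generalizing d with
  | zero => exact fun u hu => hzero u d (Or.inl hu)
  | succ k ihk =>
    induction d with
    | zero => exact fun u _ => hzero u 0 (Or.inr rfl)
    | succ d ihd =>
      intro u hu v hv
      have hf : IsNilpotent (Matrix.toLin' A) := hA.map (Matrix.toLinAlgEquiv' (R := F))
      have hmem := pow_mem_of_le_sup_span hf
        (fun v hv => mulVec_mem_jordanCorner hAJ hv)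
        (fun v hv => by
          obtain ⟨y, hy, z, hz, rfl⟩ := Submodule.mem_sup.1 hv
          rw [map_add]
          exact Submodule.add_mem_sup (mulVec_mem_jordanCorner hAJ hy)
            (mulVec_mem_jordanCorner hAJ hz)) _ (jordanCorner_le u d) hv
      rw [← Matrix.toLin'_pow, Matrix.toLin'_apply] at hmem
      obtain ⟨y, hy, z, hz, hyz⟩ := Submodule.mem_sup.1 hmem
      have hy0 := ihk (d + 1) (u + 1) (by omega) y hy
      have hz0 := ihd u hu z hz
      set e := Fintype.card {i // μ i = u + (d + 1)} with he
      rw [Fintype.card_subtype] at he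
      have h1 := hb u d
      have h2 := hb' u d
      obtain ⟨r, hr⟩ : ∃ r, b u (d + 1) = r + e := ⟨b u (d + 1) - e, by omega⟩
      rw [hr, pow_add, ← Matrix.mulVec_mulVec, ← hyz, Matrix.mulVec_add,
        hkill hy0 (by omega), hkill hz0 (by omega), add_zero]

end JordanForm

/-! ### A commuting nilpotent matrix and chains of basis vectors -/

section ChainMatrix

variable {t : ℕ}

/-- The strict order of the basis vectors along which the matrices in the nilpotent commutant of
the Jordan form act, after conjugation. -/
def JordanOrder (μ : Fin t → ℕ) (x y : Σ i : Fin t, Fin (μ i)) : Prop :=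
  (x.2 : ℕ) ≤ y.2 ∧ μ y.1 + x.2 ≤ μ x.1 + y.2 ∧ ((x.2 : ℕ) = y.2 → μ x.1 = μ y.1 → y.1 < x.1)

open Classical in
/-- The matrix with entry `1` at the pairs of basis vectors in `JordanOrder`, and `0` elsewhere. -/
noncomputable def jordanOrderMatrix (R : Type*) [Semiring R] (μ : Fin t → ℕ) :
    Matrix (Σ i : Fin t, Fin (μ i)) (Σ i : Fin t, Fin (μ i)) R :=
  Matrix.of fun x y => if JordanOrder μ x y then 1 else 0

/-- A strictly monotone function for `JordanOrder`. -/
def jordanHeight (μ : Fin t → ℕ) (x : Σ i : Fin t, Fin (μ i)) : ℤ :=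
  -- The factor `t` exceeds every block index, so the index only breaks ties.
  (2 * (x.2 : ℕ) - μ x.1 : ℤ) * t - (x.1 : ℕ)

theorem jordanHeight_lt {μ : Fin t → ℕ} {x y : Σ i : Fin t, Fin (μ i)} (h : JordanOrder μ x y) :
    jordanHeight μ x < jordanHeight μ y := by
  obtain ⟨h1, h2, h3⟩ := h
  have hx := x.1.2
  have hy := y.1.2
  unfold jordanHeight
  by_cases h4 : (x.2 : ℕ) = y.2 ∧ μ x.1 = μ y.1
  · have := h3 h4.1 h4.2
    rw [h4.1, h4.2]
    rw [Fin.lt_def] at this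
    omega
  · have : (2 * (x.2 : ℕ) - μ x.1 : ℤ) + 1 ≤ 2 * (y.2 : ℕ) - μ y.1 := by omega
    have := mul_le_mul_of_nonneg_right this (show (0 : ℤ) ≤ t by positivity)
    rw [add_mul, one_mul] at this
    omega

theorem height_add_le_of_pow_ne_zero {R : Type*} [Semiring R] {μ : Fin t → ℕ} (k : ℕ)
    (x y : Σ i : Fin t, Fin (μ i)) (h : (jordanOrderMatrix R μ ^ k) x y ≠ 0) :
    jordanHeight μ x + k ≤ jordanHeight μ y := by
  induction k generalizing x with
  | zero =>
    rw [pow_zero] at h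
    obtain rfl : x = y := by by_contra hne; exact h (Matrix.one_apply_ne hne)
    simp
  | succ k ih =>
    rw [pow_succ', Matrix.mul_apply] at h
    obtain ⟨z, -, hz⟩ := Finset.exists_ne_zero_of_sum_ne_zero h
    have h1 := ih z (right_ne_zero_of_mul hz)
    have h2 : JordanOrder μ x z := by
      by_contra hn
      exact left_ne_zero_of_mul hz (by simp [jordanOrderMatrix, hn])
    have h3 := jordanHeight_lt h2
    push_cast
    omega

theorem isNilpotent_jordanOrderMatrix {R : Type*} [Semiring R] (μ : Fin t → ℕ) :
    IsNilpotent (jordanOrderMatrix R μ) := by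
  obtain ⟨N, hN⟩ : ∃ N : ℕ, ∀ x y, jordanHeight μ y - jordanHeight μ x < N := by
    obtain ⟨N, hN⟩ := (Set.finite_range fun p : (Σ i : Fin t, Fin (μ i)) × (Σ i : Fin t, Fin (μ i)) =>
      (jordanHeight μ p.2 - jordanHeight μ p.1).toNat).bddAbove
    refine ⟨N + 1, fun x y => ?_⟩
    have := hN ⟨(x, y), rfl⟩
    simp only at this
    push_cast
    omega
  refine ⟨N, ?_⟩
  ext x y
  by_contra h
  have h1 := height_add_le_of_pow_ne_zero N x y h
  have h2 := hN x y
  omega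

/-- Shifting both positions by one preserves the relation; at a block border, where only one of the
two shifted entries exists, the relation fails. -/
theorem jordanOrderMatrix_commute {F : Type*} [Field F] (μ : Fin t → ℕ) :
    Commute (jordanOrderMatrix F μ) (nilpotentJordanForm F μ) := by
  ext ⟨i, a⟩ ⟨j, b⟩
  have hl : (jordanOrderMatrix F μ * nilpotentJordanForm F μ) ⟨i, a⟩ ⟨j, b⟩ =
      if h : 0 < (b : ℕ) then jordanOrderMatrix F μ ⟨i, a⟩ ⟨j, b - 1, by omega⟩ else 0 := by
    simp only [Matrix.mul_apply, nilpotentJordanForm_apply, mul_ite, mul_one, mul_zero]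
    split_ifs with h
    · rw [Finset.sum_eq_single ⟨j, b - 1, by omega⟩]
      · exact if_pos ⟨rfl, by simp; omega⟩
      · rintro ⟨j', b'⟩ - hne
        refine if_neg ?_
        rintro ⟨h1, h2⟩
        obtain rfl : j' = j := h1
        exact hne (by congr 1; ext; simp at h2 ⊢; omega)
      · simp
    · refine Finset.sum_eq_zero fun z _ => if_neg ?_
      rintro ⟨-, h2⟩
      exact h (h2 ▸ Nat.succ_pos _)
  have hr : (nilpotentJordanForm F μ * jordanOrderMatrix F μ) ⟨i, a⟩ ⟨j, b⟩ =
      if h : (a : ℕ) + 1 < μ i then jordanOrderMatrix F μ ⟨i, a + 1, h⟩ ⟨j, b⟩ else 0 := by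
    exact nilpotentJordanForm_mulVec (fun x => jordanOrderMatrix F μ x ⟨j, b⟩) i a
  rw [hl, hr]
  have ha := a.2
  have hb := b.2
  split_ifs with h1 h2 h2
  · simp only [jordanOrderMatrix, Matrix.of_apply]
    congr 1
    simp only [JordanOrder, eq_iff_iff]
    refine and_congr (by omega) (and_congr (by omega) ?_)
    rw [show (a : ℕ) = b - 1 ↔ (a : ℕ) + 1 = b by omega]
  · simp only [jordanOrderMatrix, Matrix.of_apply]
    refine if_neg fun h => ?_
    have := h.2.1
    simp only at this
    omega
  · simp only [jordanOrderMatrix, Matrix.of_apply]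
    refine (if_neg fun h => ?_).symm
    have := h.1
    simp only at this
    omega
  · rfl

/-- Over `ℕ` walks cannot cancel. The element of least height precedes all others in `S`, so it
extends any walk starting among them. -/
theorem exists_jordanOrderMatrix_pow_pos {μ : Fin t → ℕ} (k : ℕ) (S : Finset (Σ i : Fin t, Fin (μ i)))
    (hS : S.card = k + 1)
    (hchain : ∀ x ∈ S, ∀ y ∈ S, x ≠ y → JordanOrder μ x y ∨ JordanOrder μ y x) :
    ∃ x ∈ S, ∃ y, 0 < (jordanOrderMatrix ℕ μ ^ k) x y := by
  classical
  induction k generalizing S with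
  | zero =>
    obtain ⟨x, rfl⟩ := Finset.card_eq_one.1 hS
    exact ⟨x, by simp, x, by simp⟩
  | succ k ih =>
    obtain ⟨x, hx, hmin⟩ := S.exists_min_image (jordanHeight μ) (Finset.card_pos.1 (by omega))
    obtain ⟨z, hz, y, hy⟩ := ih (S.erase x) (by rw [Finset.card_erase_of_mem hx]; omega)
      fun a ha b hb => hchain a (Finset.mem_of_mem_erase ha) b (Finset.mem_of_mem_erase hb)
    rw [Finset.mem_erase] at hz
    refine ⟨x, hx, y, ?_⟩
    rw [pow_succ', Matrix.mul_apply]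
    refine Finset.sum_pos' (fun _ _ => Nat.zero_le _) ⟨z, Finset.mem_univ _, ?_⟩
    have hxz : JordanOrder μ x z := by
      refine (hchain x hx z hz.2 hz.1.symm).resolve_right fun h => ?_
      exact absurd (jordanHeight_lt h) (not_lt.2 (hmin z hz.2))
    simpa [jordanOrderMatrix, hxz] using hy

theorem jordanOrderMatrix_pow_ne_zero {F : Type*} [Field F] [CharZero F] {μ : Fin t → ℕ} (k : ℕ)
    (S : Finset (Σ i : Fin t, Fin (μ i))) (hS : S.card = k + 1)
    (hchain : ∀ x ∈ S, ∀ y ∈ S, x ≠ y → JordanOrder μ x y ∨ JordanOrder μ y x) :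
    jordanOrderMatrix F μ ^ k ≠ 0 := by
  obtain ⟨x, -, y, h⟩ := exists_jordanOrderMatrix_pow_pos k S hS hchain
  intro h0
  have hmap : jordanOrderMatrix F μ = (Nat.castRingHom F).mapMatrix (jordanOrderMatrix ℕ μ) := by
    ext x y
    simp [jordanOrderMatrix]
  rw [hmap, ← map_pow] at h0
  have := congrFun (congrFun h0 x) y
  simp at this
  omega

/-- Take the two end vectors of each block before `p` and all vectors of the blocks `p, …, q`. The
earlier blocks are larger than `μ p ≥ 1`, so their ends are distinct; orders differing by at most
`1` make the middle vectors comparable. -/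
theorem exists_chain {μ : Fin t → ℕ} (hanti : Antitone μ) (hpos : ∀ i, 0 < μ i) {p q : Fin t}
    (hle : μ p ≤ μ q + 1) (hne : ∀ j : Fin t, (j : ℕ) + 1 = p → μ j ≠ μ p) :
    ∃ S : Finset (Σ i : Fin t, Fin (μ i)), S.card = 2 * (p : ℕ) + ∑ k ∈ Finset.Icc p q, μ k ∧
      ∀ x ∈ S, ∀ y ∈ S, x ≠ y → JordanOrder μ x y ∨ JordanOrder μ y x := by
  classical
  have hlarge : ∀ i, i < p → μ p + 1 ≤ μ i := by
    intro i hi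
    rw [Fin.lt_def] at hi
    have h1 := hne ⟨p - 1, by omega⟩ (by simp; omega)
    have h2 : μ p ≤ μ ⟨p - 1, by omega⟩ := hanti (by rw [Fin.le_def]; simp)
    have h3 : μ ⟨p - 1, by omega⟩ ≤ μ i := hanti (by rw [Fin.le_def]; simp; omega)
    omega
  have hmid : ∀ i, p ≤ i → i ≤ q → μ i ≤ μ p ∧ μ p ≤ μ i + 1 := fun i h1 h2 =>
    ⟨hanti h1, hle.trans (Nat.succ_le_succ (hanti h2))⟩
  refine ⟨Finset.univ.sigma fun i => if i < p then
      {⟨0, hpos i⟩, ⟨μ i - 1, Nat.sub_lt (hpos i) one_pos⟩}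
    else if i ≤ q then Finset.univ else ∅, ?_, ?_⟩
  · rw [Finset.card_sigma]
    have h1 : ∀ i, (if i < p then
        ({⟨0, hpos i⟩, ⟨μ i - 1, Nat.sub_lt (hpos i) one_pos⟩} : Finset (Fin (μ i)))
        else if i ≤ q then Finset.univ else ∅).card =
        (if i ∈ Finset.Iio p then 2 else 0) + if i ∈ Finset.Icc p q then μ i else 0 := by
      intro i
      simp only [Finset.mem_Iio, Finset.mem_Icc]
      by_cases hi : i < p
      · rw [if_pos hi, if_pos hi, if_neg (by simp [hi]), Finset.card_pair]
        have := hlarge i hi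
        have := hpos p
        simp
        omega
      · rw [if_neg hi, if_neg hi]
        by_cases hq : i ≤ q
        · simp [hq, not_lt.1 hi]
        · simp [hq]
    rw [Finset.sum_congr rfl fun i _ => h1 i, Finset.sum_add_distrib, Finset.sum_ite_mem,
      Finset.sum_ite_mem]
    simp [mul_comm]
  · have hmem : ∀ x : Σ i : Fin t, Fin (μ i), (x ∈ Finset.univ.sigma fun i => if i < p then
        ({⟨0, hpos i⟩, ⟨μ i - 1, Nat.sub_lt (hpos i) one_pos⟩} : Finset (Fin (μ i)))
        else if i ≤ q then Finset.univ else ∅) →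
        ((x.2 : ℕ) = 0 ∨ (x.2 : ℕ) + 1 = μ x.1) ∧ μ p + 1 ≤ μ x.1 ∨
          μ x.1 ≤ μ p ∧ μ p ≤ μ x.1 + 1 := by
      rintro ⟨i, a⟩ hx
      rw [Finset.mem_sigma] at hx
      have hx := hx.2
      simp only at hx
      have := hpos i
      split_ifs at hx with h1 h2
      · left
        refine ⟨?_, hlarge i h1⟩
        simp only [Finset.mem_insert, Finset.mem_singleton, Fin.ext_iff] at hx
        simp only
        omega
      · exact Or.inr (hmid i (not_lt.1 h1) h2)
      · simp at hx
    rintro x hx y hy hxy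
    have h1 := hmem x hx
    have h2 := hmem y hy
    have hx2 := x.2.2
    have hy2 := y.2.2
    have hp := hpos p
    have h3 : (x.2 : ℕ) = y.2 → μ x.1 = μ y.1 → (x.1 : ℕ) ≠ y.1 := by
      intro h _ h'
      obtain ⟨i, a⟩ := x
      obtain ⟨j, b⟩ := y
      obtain rfl : i = j := Fin.ext h'
      exact hxy (by congr 1; exact Fin.ext h)
    simp only [JordanOrder, Fin.lt_def]
    omega

end ChainMatrix

/-! ### From multiplicities of parts to chain lengths -/

section Partition

variable {t : ℕ} {μ : Fin t → ℕ}

theorem sum_card_fiber_Ioc (μ : Fin t → ℕ) {M : ℕ} (hM : ∀ i, μ i ≤ M) (p : ℕ) :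
    ∑ q ∈ Finset.Ioc p M, (Finset.univ.filter fun i => μ i = q).card =
      (Finset.univ.filter fun i => p < μ i).card := by
  rw [Finset.card_eq_sum_card_fiberwise (f := μ) (t := Finset.Ioc p M)]
  · refine Finset.sum_congr rfl fun q hq => ?_
    rw [Finset.filter_filter]
    congr 1
    ext i
    rw [Finset.mem_Ioc] at hq
    simp
    omega
  · intro i hi
    simpa [hM i] using hi

theorem chainWeight_mem_chainLengths (hanti : Antitone μ) (hpos : ∀ i, 0 < μ i) {M : ℕ}
    (hM : ∀ i, μ i ≤ M) {p : ℕ} (hp : (Finset.univ.filter fun i => μ i = p).card ≠ 0) :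
    chainWeight (fun q => (Finset.univ.filter fun i => μ i = q).card) M p ∈ chainLengths μ := by
  have hne : (Finset.univ.filter fun i => μ i = p).Nonempty :=
    Finset.card_pos.1 (Nat.pos_of_ne_zero hp)
  have hne' : (Finset.univ.filter fun i => p ≤ μ i + 1).Nonempty := by
    obtain ⟨i, hi⟩ := hne
    exact ⟨i, by simp at hi ⊢; omega⟩
  -- `P` is the first index with part `p`, `Q` the last with part at least `p - 1`.
  obtain ⟨P, hP, hPmin⟩ := Finset.exists_min_image _ id hne
  obtain ⟨Q, hQ, hQmax⟩ := Finset.exists_max_image _ id hne'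
  simp only [Finset.mem_filter, Finset.mem_univ, true_and, id] at hP hPmin hQ hQmax
  have hlt : ∀ i, p < μ i ↔ i < P := by
    intro i
    constructor
    · intro h
      by_contra hn
      have := hanti (not_lt.1 hn)
      omega
    · intro h
      have h1 := hanti h.le
      refine lt_of_le_of_ne (hP ▸ h1) fun h2 => ?_
      exact absurd (hPmin i h2.symm) (not_le.2 h)
  have hge : ∀ i, p ≤ μ i + 1 ↔ i ≤ Q := fun i =>
    ⟨hQmax i, fun h => hQ.trans (Nat.succ_le_succ (hanti h))⟩
  refine ⟨P, Q, hQmax P (by omega), by omega, ?_, ?_⟩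
  · intro j hj h
    have := hPmin j (h.trans hP)
    rw [Fin.le_def] at this
    omega
  · rw [chainWeight, sum_card_fiber_Ioc μ hM]
    have h1 : (Finset.univ.filter fun i => p < μ i) = Finset.Iio P := by
      ext i
      simp [hlt]
    have h2 : Finset.Icc P Q = (Finset.univ.filter fun i => μ i = p) ∪
        (Finset.univ.filter fun i => μ i = p - 1) := by
      ext i
      have h3 := hlt i
      have h4 := hge i
      have h5 := hpos i
      simp only [Finset.mem_Icc, Finset.mem_union, Finset.mem_filter, Finset.mem_univ, true_and]
      rw [← h4, ← not_lt, ← h3]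
      omega
    rw [h1, h2, Finset.sum_union, Fin.card_Iio, add_assoc]
    · congr 2
      · rw [Finset.sum_congr rfl fun i hi => (Finset.mem_filter.1 hi).2]
        simp [mul_comm]
      · rw [Finset.sum_congr rfl fun i hi => (Finset.mem_filter.1 hi).2]
        simp [mul_comm]
    · rw [Finset.disjoint_left]
      intro i hi hi'
      have := hpos i
      simp at hi hi'
      omega

theorem exists_isGreatest_chainLengths (ht : 0 < t) (μ : Fin t → ℕ) :
    ∃ m, IsGreatest (chainLengths μ) m := by
  have hfin : (chainLengths μ).Finite := by
    refine (Set.finite_range fun x : Fin t × Fin t =>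
      2 * (x.1 : ℕ) + ∑ k ∈ Finset.Icc x.1 x.2, μ k).subset ?_
    rintro v ⟨p, q, -, -, -, rfl⟩
    exact ⟨(p, q), rfl⟩
  have hne : (chainLengths μ).Nonempty :=
    ⟨_, ⟨0, ht⟩, ⟨0, ht⟩, le_rfl, by omega, fun j hj => by simp at hj, rfl⟩
  exact ⟨sSup (chainLengths μ), Nat.sSup_mem hne hfin.bddAbove, fun v hv => le_csSup hfin.bddAbove hv⟩

theorem pos_of_mem_chainLengths (hpos : ∀ i, 0 < μ i) {v : ℕ} (hv : v ∈ chainLengths μ) :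
    0 < v := by
  obtain ⟨p, q, hpq, -, -, rfl⟩ := hv
  have := Finset.sum_pos (s := Finset.Icc p q) (f := μ) (fun i _ => hpos i)
    ⟨p, by simpa using hpq⟩
  omega

theorem pow_eq_zero_of_commute_nilpotentJordanForm {F : Type*} [Field F] (hanti : Antitone μ)
    (hpos : ∀ i, 0 < μ i) {m : ℕ} (hm : m ∈ upperBounds (chainLengths μ))
    {A : Matrix (Σ i : Fin t, Fin (μ i)) (Σ i : Fin t, Fin (μ i)) F}
    (hA : IsNilpotent A) (hAJ : Commute A (nilpotentJordanForm F μ)) : A ^ m = 0 := by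
  set M := Finset.univ.sup μ
  have hM : ∀ i, μ i ≤ M := fun i => Finset.le_sup (Finset.mem_univ i)
  set c : ℕ → ℕ := fun q => (Finset.univ.filter fun i => μ i = q).card with hcdef
  have hc : ∀ q, M < q → c q = 0 := by
    intro q hq
    rw [hcdef, Finset.card_eq_zero, Finset.filter_eq_empty_iff]
    intro i _ h
    have := hM i
    omega
  have hle : pathBound c M 0 M ≤ m := pathBound_zero_le c M m hc fun p hp =>
    chainWeight_le c M m hc (fun q _ hq => hm (chainWeight_mem_chainLengths hanti hpos hM hq)) hp
  refine pow_eq_zero_of_le hle (Matrix.toLin'.injective (LinearMap.ext fun v => ?_))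
  rw [map_zero, LinearMap.zero_apply, Matrix.toLin'_apply]
  -- The corner at `(0, M)` is the whole space, since no block is longer than `M`.
  refine pow_mulVec_eq_zero hA hAJ (pathBound_up c M · · hc) (pathBound_right c M) hM M M 0
    (by omega) v fun x _ => ?_
  have := hM x.1
  omega

end Partition

/-! ### Transfer from the Jordan form to `B` -/

theorem HasShape.exists_ringEquiv {F : Type*} [Field F] {n t : ℕ} {B : Matrix (Fin n) (Fin n) F}
    {μ : Fin t → ℕ} (h : HasShape B μ) :
    ∃ φ : Matrix (Σ i : Fin t, Fin (μ i)) (Σ i : Fin t, Fin (μ i)) F ≃+*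
      Matrix (Fin n) (Fin n) F,
      φ (nilpotentJordanForm F μ) = B := by
  obtain ⟨e, P, rfl⟩ := h.similar
  exact ⟨(Matrix.reindexAlgEquiv F F e).toRingEquiv.trans
    (MulSemiringAction.toRingEquiv _ _ (ConjAct.toConjAct P)), rfl⟩

/-- The maximal index of nilpotency in `𝒩_B` equals the maximum of the numbers
`2i + μ_{i+1} + ⋯ + μ_{i+r}`; both maxima are attained. -/
theorem mainTheorem1 {F : Type*} [Field F] [CharZero F] {n t : ℕ} (hn : 0 < n)
    (B : Matrix (Fin n) (Fin n) F) (hB : IsNilpotent B)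
    (μ : Fin t → ℕ) (hμ : HasShape B μ) :
    ∃ m : ℕ, IsGreatest {k : ℕ | ∃ A ∈ nilpotentCommutant B, nilpotencyClass A = k} m ∧
      IsGreatest (chainLengths μ) m := by
  have ht : 0 < t := by
    obtain ⟨e, -⟩ := hμ.similar
    exact (e.symm ⟨0, hn⟩).1.pos
  obtain ⟨m, hm⟩ := exists_isGreatest_chainLengths ht μ
  obtain ⟨φ, rfl⟩ := hμ.exists_ringEquiv
  have hzero : ∀ A ∈ nilpotentCommutant (φ (nilpotentJordanForm F μ)), A ^ m = 0 := by
    rintro A ⟨hA, hAB⟩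
    obtain ⟨A, rfl⟩ := φ.surjective A
    rw [← map_mul, ← map_mul] at hAB
    rw [← map_pow, pow_eq_zero_of_commute_nilpotentJordanForm hμ.antitone hμ.pos hm.2
      ((IsNilpotent.map_iff φ.injective).1 hA) (φ.injective hAB), map_zero]
  refine ⟨m, ⟨⟨φ (jordanOrderMatrix F μ), ⟨(isNilpotent_jordanOrderMatrix μ).map φ, ?_⟩, ?_⟩, ?_⟩, hm⟩
  · rw [← map_mul, ← map_mul, (jordanOrderMatrix_commute μ).eq]
  · obtain ⟨k, rfl⟩ := Nat.exists_eq_succ_of_ne_zero (pos_of_mem_chainLengths hμ.pos hm.1).ne'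
    refine nilpotencyClass_eq_succ_iff.2 ⟨hzero _ ⟨(isNilpotent_jordanOrderMatrix μ).map φ, ?_⟩, ?_⟩
    · rw [← map_mul, ← map_mul, (jordanOrderMatrix_commute μ).eq]
    · obtain ⟨p, q, -, hle, hne, hk⟩ := hm.1
      obtain ⟨S, hS, hchain⟩ := exists_chain hμ.antitone hμ.pos hle hne
      rw [← map_pow, Ne, map_eq_zero_iff φ φ.injective]
      exact jordanOrderMatrix_pow_ne_zero k S (hS.trans hk.symm) hchain
  · rintro _ ⟨A, hA, rfl⟩
    exact Nat.sInf_le (hzero A hA)
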